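/- Let $m,q\ge 0$ be integers, $n=2m$, and $$A=\begin{pmatrix}0&I_m\\0&0\end{pmatrix}\in\mathbb R^{n\times n},\qquad B=\begin{pmatrix}0\\ I_m\end{pmatrix}\in\mathbb R^{n\times m},\qquad C\in\mathbb R^{q\times n},$$ with $(A,C)$ observable. Let $\sigma$ denote the componentwise standard saturation, $\sigma(v)_k=\operatorname{sgn}(v_k)\min(1,|v_k|)$. Networks. For $N$ agents consider $\dot x_i=Ax_i+B\sigma(u_i)$, $y_i=Cx_i$, $i=1,\dots,N$, and the exosystem $\dot x_r=Ax_r$, $y_r=Cx_r$. A weighted graph on $\{1,\dots,N\}$ is given by weights $a_{ij}\ge 0$ with $a_{ii}=0$; there is an edge from $j$ to $i$ iff $a_{ij}>0$. For a nonempty set of nodes $\mathscr C$ let $\iota_i=1$ if $i\in\mathscr C$ and $\iota_i=0$ otherwise, and let $\mathbb G^N_{\mathscr C}$ be the set of weighted graphs on $N$ nodes in which every node belongs to a directed tree (a subgraph with a root that has no parent, in which every other node has exactly one parent and is reached from the root by a directed path of the subgraph) whose root lies in $\mathscr C$. Agent $i$ receives $$\bar\zeta_i=\sum_{j=1}^N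 a_{ij}(y_i-y_j)+\iota_i(y_i-y_r),\qquad \hat\zeta_i=\sum_{j=1}^N a_{ij}(\xi_i-\xi_j),$$ where $\xi_j$ is a variable communicated by agent $j$. Regulated state synchronization means that $x_i(t)-x_r(t)\to 0$ for all $i$, and hence $x_i(t)-x_j(t)\to0$ for all $i,j$, as $t\to\infty$. Claim. (1) The scalable global regulated state synchronization problem is solvable: there is a linear dynamic protocol $$\dot x_{c,i}=A_cx_{c,i}+B_c\sigma(u_i)+C_c\bar\zeta_i+D_c\hat\zeta_i+\iota_iE_c\xi_i,\qquad u_i=F_cx_{c,i},\qquad \xi_i=H_cx_{c,i}+J_c\sigma(u_i),$$ whose dimensions and real coefficient matrices depend only on $(A,B,C)$, such that regulated state synchronization holds for every $N$, every nonempty $\mathscr C\subseteq\{1,\dots,N\}$, every graph in $\mathbb G^N_{\mathscr C}$ and all initial conditions of the agents, of the exosystem and of the protocols. (2) In particular, let $F\in\mathbb R^{n\times q}$ be any matrix such that $A-FC$ is Hurwitz stable (all eigenvalues have negative real part), let $K=(K_1\ \ K_2)$ with arbitrary (symmetric) negative definite $K_1,K_2\in\mathbb R^{m\times m}$, and let $\rho>0$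 be arbitrary. Then the protocol $$\begin{aligned}\dot{\hat x}_i&=A\hat x_i+B\sum_{j=1}^Na_{ij}\bigl(\sigma(u_i)-\sigma(u_j)\bigr)+F(\bar\zeta_i-C\hat x_i)+\iota_iB\sigma(u_i),\\ \dot\chi_i&=A\chi_i+B\sigma(u_i)+\hat x_i-\sum_{j=1}^Na_{ij}(\chi_i-\chi_j)-\iota_i\chi_i,\\ u_i&=\rho K\chi_i\end{aligned}$$ achieves regulated state synchronization for every $N$, every nonempty $\mathscr C\subseteq\{1,\dots,N\}$, every graph in $\mathbb G^N_{\mathscr C}$ and all initial conditions of $x_i$, $x_r$, $\hat x_i$, $\chi_i$. -/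

import Mathlib

open Filter Topology Matrix

namespace MAS

/-- The standard saturation function `sat w = sgn w * min (1, |w|)`. -/
noncomputable def sat (w : ℝ) : ℝ := Real.sign w * min 1 |w|

/-- Componentwise saturation. -/
noncomputable def satVec {m : Type*} (v : m → ℝ) : m → ℝ := fun k => sat (v k)

/-- A real square matrix is Hurwitz stable if all its complex eigenvalues lie in the open left
half plane. -/
def IsHurwitz {n : Type*} [Fintype n] [DecidableEq n] (M : Matrix n n ℝ) : Prop :=
  ∀ z : ℂ, Module.End.HasEigenvalue (Matrix.toLin' (M.map Complex.ofReal)) z → z.re < 0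

/-- A real square matrix is negative definite (in particular symmetric). -/
def IsNegDef {m : Type*} [Fintype m] (M : Matrix m m ℝ) : Prop := (-M).PosDef

/-- The observability matrix with block rows `C, C A, ..., C A ^ (n - 1)`. -/
def observabilityMatrix {n q : Type*} [Fintype n] [DecidableEq n]
    (A : Matrix n n ℝ) (C : Matrix q n ℝ) : Matrix (Fin (Fintype.card n) × q) n ℝ :=
  Matrix.of fun ki j => (C * A ^ (ki.1 : ℕ)) ki.2 j

/-- The pair `(A, C)` is observable: its observability matrix has full column rank. -/
def IsObservable {n q : Type*} [Fintype n] [DecidableEq n]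
    (A : Matrix n n ℝ) (C : Matrix q n ℝ) : Prop :=
  (observabilityMatrix A C).rank = Fintype.card n

/-- A weighted directed graph on `N` nodes, given by its weighted adjacency matrix. -/
structure WeightedGraph (N : ℕ) where
  a : Matrix (Fin N) (Fin N) ℝ
  a_nonneg : ∀ i j, 0 ≤ a i j
  a_diag : ∀ i, a i i = 0

/-- There is an edge from `j` to `i` exactly when `a i j > 0`. -/
def WeightedGraph.Edge {N : ℕ} (G : WeightedGraph N) (j i : Fin N) : Prop := 0 < G.a i j

/-- The subgraph of `G` with node set `V` and edge relation `E` is a directed tree with root `r`: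
the root has no parent, every other node has exactly one parent, and the root has a directed path
(inside the tree) to every node of the tree. -/
structure WeightedGraph.IsDirectedTree {N : ℕ} (G : WeightedGraph N)
    (V : Set (Fin N)) (E : Fin N → Fin N → Prop) (r : Fin N) : Prop where
  subgraph : ∀ j i, E j i → j ∈ V ∧ i ∈ V ∧ G.Edge j i
  root_mem : r ∈ V
  root_no_parent : ∀ j, ¬ E j r
  unique_parent : ∀ i ∈ V, i ≠ r → ∃! j, E j i
  path_from_root : ∀ i ∈ V, Relation.ReflTransGen E r i

/-- The set of all graphs with `N` nodes such that every node is a member of a directed tree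
whose root lies in the node set `R`. -/
def graphsRootedIn {N : ℕ} (R : Finset (Fin N)) : Set (WeightedGraph N) :=
  {G | ∀ i, ∃ (V : Set (Fin N)) (E : Fin N → Fin N → Prop) (r : Fin N),
    G.IsDirectedTree V E r ∧ r ∈ R ∧ i ∈ V}

/-- The indicator `ι_i` of the agents that measure their output relative to the exosystem. -/
def iota {N : ℕ} (R : Finset (Fin N)) (i : Fin N) : ℝ := if i ∈ R then 1 else 0

/-- The diffusive network signal `∑ j, a i j (v i - v j)` received by agent `i`. -/
def WeightedGraph.diffusive {N : ℕ} (G : WeightedGraph N) {k : Type*} (v : Fin N → k → ℝ)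
    (i : Fin N) : k → ℝ :=
  ∑ j, G.a i j • (v i - v j)

/-- The network measurement `∑ j, a i j (y i - y j) + ι_i (y i - y_r)`, where `y i = C (x i)`
and `y_r = C x_r`. -/
def measurement {N : ℕ} (G : WeightedGraph N) (R : Finset (Fin N)) {n q : Type*} [Fintype n]
    (C : Matrix q n ℝ) (x : Fin N → n → ℝ) (xr : n → ℝ) (i : Fin N) : q → ℝ :=
  G.diffusive (fun j => C *ᵥ x j) i + iota R i • (C *ᵥ x i - C *ᵥ xr)

/-- `v` solves `v' = f` on `[0, ∞)`, with a one-sided derivative at `0`. -/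
def SolvesODE {k : Type*} [Fintype k] (v f : ℝ → k → ℝ) : Prop :=
  ∀ t, 0 ≤ t → HasDerivWithinAt v (f t) (Set.Ici 0) t

/-- Regulated state synchronization: all agents converge to the trajectory of the exosystem,
and to one another. -/
def RegulatedSync {N : ℕ} {n : Type*} (x : Fin N → ℝ → n → ℝ) (xr : ℝ → n → ℝ) : Prop :=
  (∀ i, Tendsto (fun t => x i t - xr t) atTop (𝓝 0)) ∧
    ∀ i j, Tendsto (fun t => x i t - x j t) atTop (𝓝 0)

/-- The coefficients of a linear dynamic protocol with state space `ℝ^s` and exchanged variable in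
`ℝ^p`, for agents with inputs in `ℝ^m` and outputs in `ℝ^q`. The protocol is
`xc_i' = Ac xc_i + Bc σ(u_i) + Cc ζbar_i + Dc ζhat_i + ι_i Ec ξ_i`, `u_i = Fc xc_i`,
where agent `i` communicates `ξ_i = Hc xc_i + Jc σ(u_i)`, and
`ζhat_i = ∑ j, a i j (ξ_i - ξ_j)`. -/
structure LinearProtocol (s p m q : Type*) where
  Ac : Matrix s s ℝ
  Bc : Matrix s m ℝ
  Cc : Matrix s q ℝ
  Dc : Matrix s p ℝ
  Ec : Matrix s p ℝ
  Fc : Matrix m s ℝ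
  Hc : Matrix p s ℝ
  Jc : Matrix p m ℝ

section

variable {n m q s p : Type*} [Fintype n] [Fintype m] [Fintype q] [Fintype s] [Fintype p]

/-- The input `u = Fc xc`. -/
def LinearProtocol.input (P : LinearProtocol s p m q) (xc : s → ℝ) : m → ℝ := P.Fc *ᵥ xc

/-- The communicated variable `ξ = Hc xc + Jc σ(u)`. -/
noncomputable def LinearProtocol.exchanged (P : LinearProtocol s p m q) (xc : s → ℝ) : p → ℝ :=
  P.Hc *ᵥ xc + P.Jc *ᵥ satVec (P.input xc)

/-- Trajectories on `[0, ∞)` of the agents `x_i' = A x_i + B σ(u_i)`, `y_i = C x_i`, and of the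
exosystem `x_r' = A x_r`, `y_r = C x_r`, in closed loop with a linear protocol. -/
structure LinearProtocol.IsTrajectory (P : LinearProtocol s p m q)
    (A : Matrix n n ℝ) (B : Matrix n m ℝ) (C : Matrix q n ℝ)
    {N : ℕ} (G : WeightedGraph N) (R : Finset (Fin N))
    (x : Fin N → ℝ → n → ℝ) (xr : ℝ → n → ℝ) (xc : Fin N → ℝ → s → ℝ) : Prop where
  exosystem : SolvesODE xr (fun t => A *ᵥ xr t)
  agent : ∀ i, SolvesODE (x i) (fun t => A *ᵥ x i t + B *ᵥ satVec (P.input (xc i t)))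
  protocol : ∀ i, SolvesODE (xc i) (fun t =>
    P.Ac *ᵥ xc i t + P.Bc *ᵥ satVec (P.input (xc i t))
      + P.Cc *ᵥ measurement G R C (fun j => x j t) (xr t) i
      + P.Dc *ᵥ G.diffusive (fun j => P.exchanged (xc j t)) i
      + iota R i • (P.Ec *ᵥ P.exchanged (xc i t)))

/-- The scalable global regulated state synchronization problem based on localized information
exchange is solvable for the agent model `(A, B, C)`: one linear protocol, chosen from `(A, B, C)`
alone, achieves regulated state synchronization for every number of agents, every nonempty root
set, every admissible graph and all initial conditions. -/
def ScalableSyncSolvable (A : Matrix n n ℝ) (B : Matrix n m ℝ) (C : Matrix q n ℝ) : Prop :=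
  ∃ (s p : Type) (_ : Fintype s) (_ : Fintype p) (P : LinearProtocol s p m q),
    ∀ (N : ℕ) (R : Finset (Fin N)), R.Nonempty → ∀ G ∈ graphsRootedIn R,
      ∀ (x : Fin N → ℝ → n → ℝ) (xr : ℝ → n → ℝ) (xc : Fin N → ℝ → s → ℝ),
        P.IsTrajectory A B C G R x xr xc → RegulatedSync x xr

/-- Trajectories on `[0, ∞)` of the agents and the exosystem in closed loop with the observer-based
protocol with observer state `xhat_i`, controller state `χ_i`, input `u_i = ρ K χ_i`, observer gain
`Fo`, and network signals `ζbar_i`, `ζhat_{i1} = ∑ j, a i j (χ_i - χ_j)`,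
`ζhat_{i2} = ∑ j, a i j (σ(u_i) - σ(u_j))`. -/
structure IsObserverTrajectory (A : Matrix n n ℝ) (B : Matrix n m ℝ) (C : Matrix q n ℝ)
    (Fo : Matrix n q ℝ) (K : Matrix m n ℝ) (ρ : ℝ)
    {N : ℕ} (G : WeightedGraph N) (R : Finset (Fin N))
    (x : Fin N → ℝ → n → ℝ) (xr : ℝ → n → ℝ) (xhat χ : Fin N → ℝ → n → ℝ)
    (u : Fin N → ℝ → m → ℝ) : Prop where
  exosystem : SolvesODE xr (fun t => A *ᵥ xr t)
  agent : ∀ i, SolvesODE (x i) (fun t => A *ᵥ x i t + B *ᵥ satVec (u i t))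
  observer : ∀ i, SolvesODE (xhat i) (fun t =>
    A *ᵥ xhat i t + B *ᵥ G.diffusive (fun j => satVec (u j t)) i
      + Fo *ᵥ (measurement G R C (fun j => x j t) (xr t) i - C *ᵥ xhat i t)
      + iota R i • (B *ᵥ satVec (u i t)))
  controller : ∀ i, SolvesODE (χ i) (fun t =>
    A *ᵥ χ i t + B *ᵥ satVec (u i t) + xhat i t - G.diffusive (fun j => χ j t) i
      - iota R i • χ i t)
  input : ∀ i t, 0 ≤ t → u i t = ρ • (K *ᵥ χ i t)

end

/-- The double-integrator state matrix `[[0, I], [0, 0]]`. -/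
def doubleA (m : ℕ) : Matrix (Fin m ⊕ Fin m) (Fin m ⊕ Fin m) ℝ := Matrix.fromBlocks 0 1 0 0

/-- The double-integrator input matrix `[[0], [I]]`. -/
def doubleB (m : ℕ) : Matrix (Fin m ⊕ Fin m) (Fin m) ℝ := Matrix.fromRows 0 1

end MAS

/-!
Write `e_i` for the tracking error `x_i - x_r` and `Λ = L + diag ι` for the grounded Laplacian, so that
the network measurement is `C` applied to `∑ j, Λ i j e_j`.

The saturated inputs cancel in two error signals, which are therefore governed by linear systems.
The observer error `∑ j, Λ i j e_j - xhat_i` satisfies `w' = (A - Fo C) w`, and the controller error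
`e_i - χ_i` satisfies `w_i' = A w_i - ∑ j, Λ i j w_j + (observer error)`. As every node is reached from
the root set, `-Λ` is Hurwitz stable (`WeightedGraph.isHurwitz_neg_groundedLaplacian`); for the double
integrator the second system splits into two equations with matrix `-Λ` in cascade, so no spectral
analysis of a Kronecker sum is needed. Both errors decay exponentially, because a Hurwitz stable system
with exponentially decaying input has exponentially decaying solutions (`IsHurwitz.expDecay`); this is
proved by integrating one linear factor of the characteristic polynomial at a time.

What remains is, for each agent separately, the double integrator `p' = v`, `v' = σ(z)`, where
`z = ρ (K₁ p + K₂ v)` up to an exponentially decaying error. With `P = -ρ K₁`, `Q = -ρ K₂` and `Φ` the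
primitive of the saturation, the function `∑ k, Φ (z k) + (v ⬝ P v) / 2` decreases at the rate
`σ(z) ⬝ Q σ(z)` up to an integrable term. An argument of Barbalat type gives `z → 0`, and then
`v → 0` and `p → 0` (`doubleIntegrator_tendsto_zero`).

The protocol is an instance of the general linear form, and observability provides a suitable gain:
it makes the position block of `C` injective, so that a left inverse turns the output into
`p + D v`, for which a stabilizing gain is explicit (`exists_isHurwitz_doubleA_sub`).
-/

/-! ### Exponentially decaying signals and Hurwitz systems -/

namespace MAS

/-- A signal on `[0, ∞)` decays exponentially. Values at negative times are irrelevant. -/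
def ExpDecay {E : Type*} [NormedAddCommGroup E] (f : ℝ → E) : Prop :=
  ∃ K a : ℝ, 0 < a ∧ ∀ t, 0 ≤ t → ‖f t‖ ≤ K * Real.exp (-a * t)

section ExpDecay

variable {E F : Type*} [NormedAddCommGroup E] [NormedAddCommGroup F]

theorem ExpDecay.of_norm_le {f : ℝ → E} {g : ℝ → F} (hf : ExpDecay f) (c : ℝ) (hc : 0 ≤ c)
    (h : ∀ t, 0 ≤ t → ‖g t‖ ≤ c * ‖f t‖) : ExpDecay g := by
  obtain ⟨K, a, ha, hK⟩ := hf
  refine ⟨c * K, a, ha, fun t ht => (h t ht).trans ?_⟩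
  rw [mul_assoc]
  exact mul_le_mul_of_nonneg_left (hK t ht) hc

theorem ExpDecay.congr {f g : ℝ → E} (hf : ExpDecay f) (h : ∀ t, 0 ≤ t → g t = f t) :
    ExpDecay g :=
  hf.of_norm_le 1 zero_le_one fun t ht => by rw [h t ht, one_mul]

theorem ExpDecay.zero : ExpDecay (fun _ => (0 : E)) :=
  ⟨0, 1, one_pos, fun t _ => by simp⟩

/-- The constant in the bound may be enlarged and the rate lowered. -/
theorem ExpDecay.exists_bound {f : ℝ → E} (hf : ExpDecay f) {b : ℝ} (hb : 0 < b) :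
    ∃ K a : ℝ, 0 ≤ K ∧ 0 < a ∧ a < b ∧ ∀ t, 0 ≤ t → ‖f t‖ ≤ K * Real.exp (-a * t) := by
  obtain ⟨K, a, ha, hK⟩ := hf
  have hK0 : 0 ≤ K := by simpa using (norm_nonneg _).trans (hK 0 le_rfl)
  refine ⟨K, min a (b / 2), hK0, lt_min ha (half_pos hb),
    (min_le_right _ _).trans_lt (half_lt_self hb), fun t ht => (hK t ht).trans ?_⟩
  gcongr
  exact min_le_left _ _

theorem ExpDecay.add {f g : ℝ → E} (hf : ExpDecay f) (hg : ExpDecay g) :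
    ExpDecay (fun t => f t + g t) := by
  obtain ⟨K, a, hK, ha, -, hf⟩ := hf.exists_bound one_pos
  obtain ⟨L, b, hL, hb, hba, hg⟩ := hg.exists_bound ha
  refine ⟨K + L, b, hb, fun t ht => (norm_add_le _ _).trans ?_⟩
  rw [add_mul]
  refine add_le_add ((hf t ht).trans ?_) (hg t ht)
  gcongr

theorem ExpDecay.neg {f : ℝ → E} (hf : ExpDecay f) : ExpDecay (fun t => -f t) :=
  hf.of_norm_le 1 zero_le_one fun t _ => by simp

theorem ExpDecay.sub {f g : ℝ → E} (hf : ExpDecay f) (hg : ExpDecay g) :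
    ExpDecay (fun t => f t - g t) := by
  simpa only [sub_eq_add_neg] using hf.add hg.neg

theorem ExpDecay.tendsto_zero {f : ℝ → E} (hf : ExpDecay f) : Tendsto f atTop (𝓝 0) := by
  obtain ⟨K, a, ha, hK⟩ := hf
  have h : Tendsto (fun t => K * Real.exp (-a * t)) atTop (𝓝 0) := by
    simpa using (Real.tendsto_exp_atBot.comp
      (tendsto_id.const_mul_atTop_of_neg (neg_lt_zero.2 ha))).const_mul K
  refine squeeze_zero_norm' ?_ h
  filter_upwards [eventually_ge_atTop 0] with t ht using hK t ht

theorem ExpDecay.clm [NormedSpace ℝ E] [NormedSpace ℝ F] (L : E →L[ℝ] F) {f : ℝ → E}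
    (hf : ExpDecay f) : ExpDecay (fun s => L (f s)) :=
  hf.of_norm_le ‖L‖ (norm_nonneg _) fun _ _ => L.le_opNorm _

theorem ExpDecay.pi {ι : Type*} [Fintype ι] {f : ℝ → ι → E} (h : ∀ i, ExpDecay (fun t => f t i)) :
    ExpDecay f := by
  have hs : ∀ s : Finset ι, ExpDecay (fun t => ∑ i ∈ s, ‖f t i‖) := by
    classical
    intro s
    induction s using Finset.induction_on with
    | empty => simpa using ExpDecay.zero (E := ℝ)
    | insert i s hi ih =>
      simp only [Finset.sum_insert hi]
      exact ((h i).of_norm_le (g := fun t => ‖f t i‖) 1 zero_le_one fun t _ => by simp).add ih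
  refine (hs Finset.univ).of_norm_le 1 zero_le_one fun t _ => ?_
  rw [one_mul, Real.norm_of_nonneg (Finset.sum_nonneg fun i _ => norm_nonneg _)]
  refine (pi_norm_le_iff_of_nonneg (Finset.sum_nonneg fun i _ => norm_nonneg _)).2 fun i => ?_
  exact Finset.single_le_sum (f := fun i => ‖f t i‖) (fun i _ => norm_nonneg _) (Finset.mem_univ i)

theorem ExpDecay.apply {ι : Type*} [Fintype ι] {f : ℝ → ι → E} (h : ExpDecay f) (i : ι) :
    ExpDecay (fun t => f t i) :=
  h.of_norm_le 1 zero_le_one fun t _ => by simpa using norm_le_pi_norm (f t) i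

end ExpDecay

/-- A one-sided derivative relative to `[0, ∞)` is one relative to `[t, ∞)`. -/
theorem hasDerivWithinAt_Ici_self {E : Type*} [NormedAddCommGroup E] [NormedSpace ℝ E]
    {v : ℝ → E} {v' : E} {t : ℝ} (ht : 0 ≤ t) (h : HasDerivWithinAt v v' (Set.Ici 0) t) :
    HasDerivWithinAt v v' (Set.Ici t) t :=
  h.mono (Set.Ici_subset_Ici.2 ht)

section Complex

variable {E : Type*} [NormedAddCommGroup E] [NormedSpace ℂ E]

/-- A first order equation with stable rate and exponentially decaying input. The decay rate of the
input is lowered below `-re l`, so that the integral of `exp (-l t) • g t` is again exponential. -/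
theorem ExpDecay.of_hasDerivWithinAt_smul_add {l : ℂ} (hl : l.re < 0) {v g : ℝ → E}
    (hv : ∀ t, 0 ≤ t → HasDerivWithinAt v (l • v t + g t) (Set.Ici 0) t) (hg : ExpDecay g) :
    ExpDecay v := by
  obtain ⟨K, a, hK, ha, hal, hg⟩ := hg.exists_bound (neg_pos.2 hl)
  set b : ℝ := -l.re - a with hb
  have hb0 : 0 < b := by linarith
  have hexp : ∀ t : ℝ, HasDerivAt (fun s : ℝ => Complex.exp (-l * s))
      (Complex.exp (-l * t) * -l) t := fun t => by
    have h1 : HasDerivAt (fun s : ℝ => -l * (s : ℂ)) (-l) t := by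
      simpa using (Complex.ofRealCLM.hasDerivAt (x := t)).const_mul (-l)
    exact h1.cexp
  have hw : ∀ t : ℝ, 0 ≤ t → HasDerivWithinAt (fun s : ℝ => Complex.exp (-l * s) • v s)
      (Complex.exp (-l * t) • g t) (Set.Ici 0) t := fun t ht => by
    have := (hexp t).hasDerivWithinAt.smul (hv t ht)
    refine this.congr_deriv ?_
    module
  have hnorm : ∀ t : ℝ, ‖Complex.exp (-l * t)‖ = Real.exp (-l.re * t) := fun t => by
    rw [Complex.norm_exp]; simp
  refine ⟨‖v 0‖ + K / b, a, ha, fun t ht => ?_⟩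
  have hB : ∀ s, HasDerivAt (fun s => ‖v 0‖ + K / b * (Real.exp (b * s) - 1))
      (K * Real.exp (b * s)) s := fun s => by
    have h1 : HasDerivAt (fun s => b * s) b s := by simpa using (hasDerivAt_id s).const_mul b
    refine (((h1.exp.sub_const 1).const_mul (K / b)).const_add _).congr_deriv ?_
    field_simp
  have key := image_norm_le_of_norm_deriv_right_le_deriv_boundary'
    (f := fun s : ℝ => Complex.exp (-l * s) • v s) (a := 0) (b := t)
    (f' := fun s => Complex.exp (-l * s) • g s)
    (fun s hs => ((hw s hs.1).continuousWithinAt).mono (fun r hr => hr.1))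
    (fun s hs => hasDerivWithinAt_Ici_self hs.1 (hw s hs.1))
    (B := fun s => ‖v 0‖ + K / b * (Real.exp (b * s) - 1)) (B' := fun s => K * Real.exp (b * s))
    (by simp) (fun s _ => (hB s).continuousAt.continuousWithinAt)
    (fun s _ => (hB s).hasDerivWithinAt)
    (fun s hs => by
      rw [norm_smul, hnorm]
      calc Real.exp (-l.re * s) * ‖g s‖ ≤ Real.exp (-l.re * s) * (K * Real.exp (-a * s)) := by
            gcongr; exact hg s hs.1
        _ = K * (Real.exp (-l.re * s) * Real.exp (-a * s)) := by ring
        _ = K * Real.exp (b * s) := by rw [← Real.exp_add]; congr 2; rw [hb]; ring)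
    (x := t) ⟨ht, le_rfl⟩
  rw [norm_smul, hnorm] at key
  have hle : ‖v 0‖ + K / b * (Real.exp (b * t) - 1) ≤ (‖v 0‖ + K / b) * Real.exp (b * t) := by
    have h1 : 1 ≤ Real.exp (b * t) := Real.one_le_exp (by positivity)
    have h2 : 0 ≤ K / b := by positivity
    nlinarith [norm_nonneg (v 0)]
  calc ‖v t‖ = Real.exp (l.re * t) * (Real.exp (-l.re * t) * ‖v t‖) := by
        rw [← mul_assoc, ← Real.exp_add]; simp
    _ ≤ Real.exp (l.re * t) * ((‖v 0‖ + K / b) * Real.exp (b * t)) := by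
        exact mul_le_mul_of_nonneg_left (key.trans hle) (Real.exp_nonneg _)
    _ = (‖v 0‖ + K / b) * (Real.exp (l.re * t) * Real.exp (b * t)) := by ring
    _ = _ := by rw [← Real.exp_add]; congr 2; rw [hb]; ring

/-- If `p` is a product of factors `X - l` with `re l < 0` and `p(T) v` decays exponentially along a
solution of `v' = T v + f`, then so does `v`: the signal `w = (T - l) v` satisfies an equation of the
same form, and `v' = l v + (w + f)`. -/
theorem ExpDecay.of_aeval_prod [FiniteDimensional ℂ E] (T : Module.End ℂ E) (s : Multiset ℂ) :
    (∀ l ∈ s, l.re < 0) → ∀ {v f : ℝ → E},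
      (∀ t, 0 ≤ t → HasDerivWithinAt v (T (v t) + f t) (Set.Ici 0) t) → ExpDecay f →
      ExpDecay (fun t => Polynomial.aeval T
        (s.map fun l => Polynomial.X - Polynomial.C l).prod (v t)) → ExpDecay v := by
  induction s using Multiset.induction_on with
  | empty =>
    intro _ v f _ _ h
    simpa using h
  | cons l s ih =>
    intro hs v f hv hf h
    let S : Module.End ℂ E := T - algebraMap ℂ (Module.End ℂ E) l
    have hS : ∀ x, S x = T x - l • x := fun x => by simp [S, Module.algebraMap_end_apply]
    let SL : E →L[ℝ] E := (LinearMap.toContinuousLinearMap S).restrictScalars ℝ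
    have hSL : ∀ x, SL x = S x := fun x => rfl
    have hw : ExpDecay (fun t => S (v t)) := by
      refine ih (fun l' hl' => hs l' (Multiset.mem_cons_of_mem hl')) (f := fun t => S (f t))
        (fun t ht => ?_) (hf.clm SL) ?_
      · have := SL.hasFDerivAt.comp_hasDerivWithinAt t (hv t ht)
        refine this.congr_deriv ?_
        simp only [hSL, hS, map_add, map_sub, map_smul]
        module
      · refine h.congr fun t _ => ?_
        have : S = Polynomial.aeval T (Polynomial.X - Polynomial.C l) := by simp [S]
        rw [Multiset.map_cons, Multiset.prod_cons, mul_comm, map_mul, this, Module.End.mul_apply]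
    refine ExpDecay.of_hasDerivWithinAt_smul_add (hs l (Multiset.mem_cons_self l s))
      (fun t ht => ?_) (hw.add hf)
    refine (hv t ht).congr_deriv ?_
    rw [hS]
    module

end Complex

/-- A Hurwitz stable system driven by an exponentially decaying input decays exponentially. -/
theorem IsHurwitz.expDecay {n : Type*} [Fintype n] [DecidableEq n] {M : Matrix n n ℝ}
    (hM : IsHurwitz M) {v f : ℝ → n → ℝ} (hv : SolvesODE v (fun t => M *ᵥ v t + f t))
    (hf : ExpDecay f) : ExpDecay v := by
  let T : Module.End ℂ (n → ℂ) := Matrix.toLin' (M.map Complex.ofReal)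
  have hprod := (IsAlgClosed.splits T.charpoly).eq_prod_roots_of_monic T.charpoly_monic
  have hc : ExpDecay (fun t i => (v t i : ℂ)) := by
    refine ExpDecay.of_aeval_prod T T.charpoly.roots (fun l hl => hM l ?_)
      (f := fun t i => (f t i : ℂ)) (fun t ht => ?_) (ExpDecay.pi fun i => ?_) ?_
    · exact (Module.End.hasEigenvalue_iff_isRoot_charpoly T l).2 (Polynomial.isRoot_of_mem_roots hl)
    · refine hasDerivWithinAt_pi.2 fun i => ?_
      refine ((hasDerivWithinAt_pi.1 (hv t ht) i).ofReal_comp).congr_deriv ?_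
      simp [T, Matrix.mulVec, dotProduct]
    · exact (hf.apply i).of_norm_le 1 zero_le_one fun t _ => by simp
    · rw [← hprod, LinearMap.aeval_self_charpoly]
      exact ExpDecay.zero
  refine ExpDecay.pi fun i => (hc.apply i).of_norm_le 1 zero_le_one fun t _ => by simp

/-! ### The grounded Laplacian of a network -/

/-- The matrix `L + diag ι`, where `L` is the Laplacian of the weighted graph `G` and `ι` is the
indicator of the root set. -/
noncomputable def WeightedGraph.groundedLaplacian {N : ℕ} (G : WeightedGraph N)
    (R : Finset (Fin N)) : Matrix (Fin N) (Fin N) ℝ :=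
  Matrix.diagonal (fun i => ∑ j, G.a i j + iota R i) - G.a

section

variable {N : ℕ} (G : WeightedGraph N) (R : Finset (Fin N))

theorem WeightedGraph.diffusive_apply {k : Type*} (v : Fin N → k → ℝ) (i : Fin N) (c : k) :
    G.diffusive v i c = ∑ j, G.a i j * (v i c - v j c) := by
  simp [WeightedGraph.diffusive, Finset.sum_apply]

theorem WeightedGraph.groundedLaplacian_mulVec (v : Fin N → ℝ) (i : Fin N) :
    (G.groundedLaplacian R *ᵥ v) i = ∑ j, G.a i j * (v i - v j) + iota R i * v i := by
  simp only [WeightedGraph.groundedLaplacian, sub_mulVec, mulVec_diagonal, Pi.sub_apply, mul_sub,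
    Finset.sum_sub_distrib, ← Finset.sum_mul]
  simp only [mulVec, dotProduct]
  ring

/-- In the coordinate `c`, the network coupling acts on the vector of all agents as the grounded
Laplacian. -/
theorem WeightedGraph.diffusive_add_iota {k : Type*} (v : Fin N → k → ℝ) (i : Fin N) (c : k) :
    G.diffusive v i c + iota R i * v i c = (G.groundedLaplacian R *ᵥ fun j => v j c) i := by
  rw [WeightedGraph.diffusive_apply, WeightedGraph.groundedLaplacian_mulVec]

variable {G R}

/-- The negative of the grounded Laplacian is Hurwitz stable if every node is reached from a root.
Otherwise take an eigenvector `z` for an eigenvalue in the closed right half plane: at a node where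
`|z|` is maximal the eigenvalue equation forces `ι = 0` and `|z|` to be maximal at all parents, so
that the maximum would be attained at a root, where `ι = 1`. -/
theorem WeightedGraph.isHurwitz_neg_groundedLaplacian (hG : G ∈ graphsRootedIn R) :
    IsHurwitz (-G.groundedLaplacian R) := by
  intro l hl
  by_contra! hre
  obtain ⟨z, hz⟩ := hl.exists_hasEigenvector
  have heq : ∀ i, ((∑ j, G.a i j + iota R i : ℝ) + l : ℂ) * z i = ∑ j, (G.a i j : ℂ) * z j := by
    intro i
    have h := congrFun hz.apply_eq_smul i
    have h2 : (toLin' ((-G.groundedLaplacian R).map Complex.ofReal) z) i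
        = ∑ j, (G.a i j : ℂ) * z j - ((∑ j, G.a i j + iota R i : ℝ) : ℂ) * z i := by
      have hentry : ∀ j, ((-G.groundedLaplacian R).map Complex.ofReal) i j
          = (G.a i j : ℂ) - if i = j then ((∑ j, G.a i j + iota R i : ℝ) : ℂ) else 0 := fun j => by
        by_cases hij : i = j
        · subst hij
          simp [WeightedGraph.groundedLaplacian]
        · simp [WeightedGraph.groundedLaplacian, hij]
      simp only [toLin'_apply, mulVec, dotProduct, hentry, sub_mul, Finset.sum_sub_distrib,
        ite_mul, zero_mul, Finset.sum_ite_eq, Finset.mem_univ, if_true]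
    rw [h2] at h
    simp only [Pi.smul_apply, smul_eq_mul] at h
    linear_combination -h
  obtain ⟨i₁, hi₁⟩ := Function.ne_iff.1 hz.2
  obtain ⟨i₀, -, hmax⟩ := Finset.exists_max_image Finset.univ (fun i => ‖z i‖) ⟨i₁, Finset.mem_univ _⟩
  have hmax : ∀ j, ‖z j‖ ≤ ‖z i₀‖ := fun j => hmax j (Finset.mem_univ j)
  have hpos : 0 < ‖z i₀‖ := (norm_pos_iff.2 hi₁).trans_le (hmax i₁)
  have hiota : ∀ i, 0 ≤ iota R i := fun i => by unfold iota; split_ifs <;> simp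
  have hstep : ∀ i, ‖z i‖ = ‖z i₀‖ → iota R i = 0 ∧ ∀ j, 0 < G.a i j → ‖z j‖ = ‖z i₀‖ := by
    intro i hi
    have h1 : (∑ j, G.a i j + iota R i) * ‖z i₀‖ ≤ ∑ j, G.a i j * ‖z j‖ := by
      calc (∑ j, G.a i j + iota R i) * ‖z i₀‖
          ≤ ‖((∑ j, G.a i j + iota R i : ℝ) + l : ℂ)‖ * ‖z i‖ := by
            rw [hi]
            refine mul_le_mul_of_nonneg_right ?_ hpos.le
            refine le_trans ?_ (Complex.re_le_norm _)
            rw [Complex.add_re, Complex.ofReal_re]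
            linarith
        _ = ‖∑ j, (G.a i j : ℂ) * z j‖ := by rw [← norm_mul, heq]
        _ ≤ ∑ j, G.a i j * ‖z j‖ := by
            refine (norm_sum_le _ _).trans (Finset.sum_le_sum fun j _ => ?_)
            rw [norm_mul, Complex.norm_real, Real.norm_of_nonneg (G.a_nonneg i j)]
    have hterm : ∀ j ∈ Finset.univ, 0 ≤ G.a i j * (‖z i₀‖ - ‖z j‖) := fun j _ =>
      mul_nonneg (G.a_nonneg i j) (sub_nonneg.2 (hmax j))
    have h2 : ∑ j, G.a i j * (‖z i₀‖ - ‖z j‖) + iota R i * ‖z i₀‖ ≤ 0 := by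
      simp only [mul_sub, Finset.sum_sub_distrib, ← Finset.sum_mul]
      linarith
    have h3 := Finset.sum_nonneg hterm
    have h4 := mul_nonneg (hiota i) hpos.le
    refine ⟨?_, fun j hj => ?_⟩
    · have : iota R i * ‖z i₀‖ = 0 := by linarith
      exact (mul_eq_zero.1 this).resolve_right hpos.ne'
    · have h5 := (Finset.sum_eq_zero_iff_of_nonneg hterm).1 (by linarith) j (Finset.mem_univ j)
      linarith [(mul_eq_zero.1 h5).resolve_left hj.ne']
  obtain ⟨V, E, r, htree, hr, hiV⟩ := hG i₀
  have hroot : ‖z r‖ = ‖z i₀‖ := by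
    refine (htree.path_from_root i₀ hiV).head_induction_on (motive := fun j _ => ‖z j‖ = ‖z i₀‖) rfl
      fun {j k} hjk _ hk => ?_
    exact (hstep k hk).2 j (htree.subgraph j k hjk).2.2
  have := (hstep r hroot).1
  simp [iota, hr] at this

end

/-! ### The saturation function -/

/-- Saturation is the projection onto `[-1, 1]`. -/
theorem sat_eq_max_min (w : ℝ) : sat w = max (-1) (min 1 w) := by
  unfold sat
  rcases lt_trichotomy w 0 with h | h | h
  · rw [Real.sign_of_neg h, abs_of_neg h, min_eq_right (by linarith : w ≤ 1), neg_one_mul,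
      ← max_neg_neg, neg_neg]
  · simp [h]
  · rw [Real.sign_of_pos h, abs_of_pos h, one_mul, max_eq_right]
    exact le_min (by norm_num) (by linarith)

theorem abs_sat_le_one (w : ℝ) : |sat w| ≤ 1 := by
  rw [sat_eq_max_min, abs_le]
  exact ⟨le_max_left _ _, max_le (by norm_num) (min_le_left _ _)⟩

theorem sat_eq_self {w : ℝ} (h : |w| ≤ 1) : sat w = w := by
  rw [sat_eq_max_min, min_eq_right (abs_le.1 h).2, max_eq_right (abs_le.1 h).1]

theorem abs_sat_sub_sat_le (v w : ℝ) : |sat v - sat w| ≤ |v - w| := by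
  rw [sat_eq_max_min, sat_eq_max_min]
  refine (abs_max_sub_max_le_max _ _ _ _).trans (max_le (by simp) ?_)
  exact (abs_min_sub_min_le_max _ _ _ _).trans (max_le (by simp) le_rfl)

theorem norm_satVec_le_one {m : Type*} [Fintype m] (v : m → ℝ) : ‖satVec v‖ ≤ 1 :=
  (pi_norm_le_iff_of_nonneg zero_le_one).2 fun k => abs_sat_le_one (v k)

theorem norm_satVec_sub_satVec_le {m : Type*} [Fintype m] (v w : m → ℝ) :
    ‖satVec v - satVec w‖ ≤ ‖v - w‖ :=
  (pi_norm_le_iff_of_nonneg (norm_nonneg _)).2 fun k =>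
    (abs_sat_sub_sat_le (v k) (w k)).trans (norm_le_pi_norm (v - w) k)

theorem tendsto_zero_of_sat {z : ℝ → ℝ} (h : Tendsto (fun t => sat (z t)) atTop (𝓝 0)) :
    Tendsto z atTop (𝓝 0) := by
  refine h.congr' ?_
  filter_upwards [h.abs.eventually_lt_const (show |(0 : ℝ)| < 1 by simp)] with t ht
  have hz : |z t| ≤ 1 := by
    by_contra! hgt
    have : |sat (z t)| = 1 := by
      have hne : z t ≠ 0 := by rintro h0; rw [h0] at hgt; simp at hgt; linarith
      unfold sat
      rw [min_eq_left hgt.le, mul_one]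
      rcases lt_or_gt_of_ne hne with h' | h'
      · rw [Real.sign_of_neg h']; simp
      · rw [Real.sign_of_pos h']; simp
    linarith
  exact sat_eq_self hz

/-- The primitive of the saturation function that vanishes at `0`. It is the maximum of
`w a - a ^ 2 / 2` over `a ∈ [-1, 1]`, attained at `a = sat w`. -/
noncomputable def satPrimitive (w : ℝ) : ℝ := w * sat w - sat w ^ 2 / 2

theorem satPrimitive_ge (w : ℝ) {a : ℝ} (ha : |a| ≤ 1) : w * a - a ^ 2 / 2 ≤ satPrimitive w := by
  obtain ⟨h1, h2⟩ := abs_le.1 ha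
  unfold satPrimitive
  rw [sat_eq_max_min]
  rcases le_total 1 w with h | h
  · rw [min_eq_left h, max_eq_right (by norm_num)]
    nlinarith
  · rw [min_eq_right h]
    rcases le_total (-1) w with h' | h'
    · rw [max_eq_right h']
      nlinarith [sq_nonneg (w - a)]
    · rw [max_eq_left h']
      nlinarith

theorem satPrimitive_nonneg (w : ℝ) : 0 ≤ satPrimitive w := by
  simpa using satPrimitive_ge w (a := 0) (by simp)

/-- The variational characterization of `satPrimitive` bounds its increments from both sides. -/
theorem hasDerivAt_satPrimitive (w : ℝ) : HasDerivAt satPrimitive (sat w) w := by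
  rw [hasDerivAt_iff_isLittleO]
  refine Asymptotics.IsBigO.trans_isLittleO (g := fun y => (y - w) ^ 2) ?_ ?_
  · refine Asymptotics.IsBigO.of_bound 1 (Eventually.of_forall fun y => ?_)
    have h1 := satPrimitive_ge y (abs_sat_le_one w)
    have h2 := satPrimitive_ge w (abs_sat_le_one y)
    have h3 : satPrimitive w = w * sat w - sat w ^ 2 / 2 := rfl
    have h4 : satPrimitive y = y * sat y - sat y ^ 2 / 2 := rfl
    have h5 : (y - w) * (sat y - sat w) ≤ (y - w) ^ 2 := by
      calc _ ≤ |(y - w) * (sat y - sat w)| := le_abs_self _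
        _ = |y - w| * |sat y - sat w| := abs_mul _ _
        _ ≤ |y - w| * |y - w| := by exact mul_le_mul_of_nonneg_left (abs_sat_sub_sat_le y w) (abs_nonneg _)
        _ = _ := by rw [abs_mul_abs_self, sq]
    rw [one_mul, smul_eq_mul, Real.norm_of_nonneg (sq_nonneg (y - w)), Real.norm_eq_abs, abs_le]
    constructor <;> nlinarith [sq_nonneg (y - w)]
  · have h : Tendsto (fun y => y - w) (𝓝 w) (𝓝 0) := by
      have hc : Continuous fun y : ℝ => y - w := by fun_prop
      simpa using hc.tendsto w
    simpa only [sq, one_mul] using ((Asymptotics.isLittleO_one_iff ℝ).2 h).mul_isBigO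
      (Asymptotics.isBigO_refl (fun y => y - w) (𝓝 w))

/-! ### Convergence lemmas of Barbalat type -/

/-- A Lipschitz signal `s` tends to zero if `-c s ^ 2` dominates the derivative of a nonnegative
function `U`: wherever `|s| ≥ ε`, the function `U` drops by a fixed amount within a fixed time, while
`U` converges. -/
theorem tendsto_zero_of_deriv_le_neg_sq {U U' s : ℝ → ℝ} {c L : ℝ} (hc : 0 < c) (hL : 0 < L)
    (hU : ∀ t, 0 ≤ t → HasDerivWithinAt U (U' t) (Set.Ici 0) t) (hU0 : ∀ t, 0 ≤ t → 0 ≤ U t)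
    (hU' : ∀ t, 0 ≤ t → U' t ≤ -c * s t ^ 2)
    (hs : ∀ t, 0 ≤ t → ∀ r, t ≤ r → |s r - s t| ≤ L * (r - t)) : Tendsto s atTop (𝓝 0) := by
  have hanti : AntitoneOn U (Set.Ici 0) := by
    refine antitoneOn_of_hasDerivWithinAt_nonpos (convex_Ici 0)
      (fun t ht => (hU t ht).continuousWithinAt) (f' := U') (fun t ht => ?_) (fun t ht => ?_)
    · exact (hU t (interior_subset ht)).mono interior_subset
    · exact (hU' t (interior_subset ht)).trans (by nlinarith [sq_nonneg (s t)])
  obtain ⟨l, hl⟩ : ∃ l, Tendsto U atTop (𝓝 l) := by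
    have h1 : Antitone (fun t => U (max t 0)) := fun t r htr =>
      hanti (Set.mem_Ici.2 (le_max_right _ _)) (Set.mem_Ici.2 (le_max_right _ _)) (max_le_max_right 0 htr)
    have h2 : BddBelow (Set.range fun t => U (max t 0)) :=
      ⟨0, by rintro _ ⟨t, rfl⟩; exact hU0 _ (le_max_right _ _)⟩
    refine ⟨_, (tendsto_atTop_ciInf h1 h2).congr' ?_⟩
    filter_upwards [eventually_ge_atTop 0] with t ht
    rw [max_eq_left ht]
  rw [Metric.tendsto_nhds]
  intro ε hε
  set h : ℝ := ε / (2 * L) with hh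
  have hh0 : 0 < h := by positivity
  have hLh : L * h = ε / 2 := by rw [hh]; field_simp
  have hdiff : Tendsto (fun t => U t - U (t + h)) atTop (𝓝 0) := by
    simpa using hl.sub (hl.comp (tendsto_atTop_add_const_right atTop h tendsto_id))
  have hdrop : 0 < c * (ε / 2) ^ 2 * h := by positivity
  filter_upwards [hdiff.eventually_lt_const hdrop, eventually_ge_atTop 0] with t ht ht0
  rw [Real.dist_0_eq_abs]
  by_contra! hgt
  have hanti2 : AntitoneOn (fun r => U r + c * (ε / 2) ^ 2 * r) (Set.Icc t (t + h)) := by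
    have hd : ∀ r ∈ Set.Icc t (t + h), HasDerivWithinAt (fun r => U r + c * (ε / 2) ^ 2 * r)
        (U' r + c * (ε / 2) ^ 2) (Set.Icc t (t + h)) r := fun r hr => by
      have h1 := (hU r (ht0.trans hr.1)).mono
        (show Set.Icc t (t + h) ⊆ Set.Ici 0 from fun x hx => ht0.trans hx.1)
      simpa using h1.fun_add ((hasDerivWithinAt_id r _).const_mul (c * (ε / 2) ^ 2))
    refine antitoneOn_of_hasDerivWithinAt_nonpos (convex_Icc _ _)
      (fun r hr => (hd r hr).continuousWithinAt) (fun r hr => (hd r (interior_subset hr)).mono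
        interior_subset) (fun r hr => ?_)
    have hr := interior_subset hr
    have h1 := hs t ht0 r hr.1
    have h2 : L * (r - t) ≤ L * h := mul_le_mul_of_nonneg_left (by linarith [hr.2]) hL.le
    have h3 : ε / 2 ≤ |s r| := by
      have := abs_sub_abs_le_abs_sub (s t) (s r)
      rw [abs_sub_comm] at this
      linarith
    have h4 : (ε / 2) ^ 2 ≤ s r ^ 2 := by
      rw [← sq_abs (s r)]
      exact pow_le_pow_left₀ (by positivity) h3 2
    have h5 := hU' r (ht0.trans hr.1)
    nlinarith
  have := hanti2 (Set.left_mem_Icc.2 (by linarith)) (Set.right_mem_Icc.2 (by linarith))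
    (by linarith : t ≤ t + h)
  simp only at this
  linarith

/-- If `y` tends to zero and its derivative `f` is Lipschitz, then `f` tends to zero. -/
theorem tendsto_deriv_zero_of_lipschitz {E : Type*} [NormedAddCommGroup E] [NormedSpace ℝ E]
    {y f : ℝ → E} {L : ℝ} (hL : 0 < L)
    (hy : ∀ t, 0 ≤ t → HasDerivWithinAt y (f t) (Set.Ici 0) t)
    (hf : ∀ t, 0 ≤ t → ∀ r, t ≤ r → ‖f r - f t‖ ≤ L * (r - t))
    (h0 : Tendsto y atTop (𝓝 0)) : Tendsto f atTop (𝓝 0) := by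
  have hinc : ∀ t, 0 ≤ t → ∀ h, 0 ≤ h → h * ‖f t‖ ≤ ‖y (t + h)‖ + ‖y t‖ + L * h * h := by
    intro t ht h hh
    have hd : ∀ r ∈ Set.Icc t (t + h), HasDerivWithinAt (fun r => y r - r • f t) (f r - f t)
        (Set.Icc t (t + h)) r := fun r hr => by
      have h1 := (hy r (ht.trans hr.1)).mono
        (show Set.Icc t (t + h) ⊆ Set.Ici 0 from fun x hx => ht.trans hx.1)
      simpa using h1.fun_sub ((hasDerivWithinAt_id r _).smul_const (f t))
    have key := Convex.norm_image_sub_le_of_norm_hasDerivWithin_le hd (C := L * h)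
      (fun r hr => (hf t ht r hr.1).trans
        (mul_le_mul_of_nonneg_left (by linarith [hr.2]) hL.le))
      (convex_Icc _ _) (Set.left_mem_Icc.2 (by linarith)) (Set.right_mem_Icc.2 (by linarith))
    have e1 : h • f t = y (t + h) - y t - (y (t + h) - (t + h) • f t - (y t - t • f t)) := by
      module
    rw [add_sub_cancel_left, Real.norm_of_nonneg hh] at key
    calc h * ‖f t‖ = ‖h • f t‖ := by rw [norm_smul, Real.norm_of_nonneg hh]
      _ ≤ ‖y (t + h)‖ + ‖y t‖ + L * h * h := by
        rw [e1]
        exact (norm_sub_le _ _).trans (add_le_add (norm_sub_le _ _) key)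
  rw [Metric.tendsto_nhds]
  intro ε hε
  set h : ℝ := ε / (2 * L) with hh
  have hh0 : 0 < h := by positivity
  have hLh : L * h = ε / 2 := by rw [hh]; field_simp
  have hsum : Tendsto (fun t => ‖y (t + h)‖ + ‖y t‖) atTop (𝓝 0) := by
    simpa using (h0.comp (tendsto_atTop_add_const_right atTop h tendsto_id)).norm.add h0.norm
  filter_upwards [hsum.eventually_lt_const (show 0 < ε / 2 * h by positivity),
    eventually_ge_atTop 0] with t ht ht0
  have := hinc t ht0 h hh0.le
  rw [dist_zero_right]
  rw [hLh] at this
  exact lt_of_mul_lt_mul_left (by linarith : h * ‖f t‖ < h * ε) hh0.le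

/-! ### The perturbed double integrator under saturated feedback -/

section

variable {m : Type*} [Fintype m]

theorem _root_.Matrix.PosDef.exists_coercive {P : Matrix m m ℝ} (hP : P.PosDef) :
    ∃ c, 0 < c ∧ ∀ x : m → ℝ, c * ‖x‖ ^ 2 ≤ x ⬝ᵥ (P *ᵥ x) := by
  have hcont : Continuous (fun x : m → ℝ => x ⬝ᵥ (P *ᵥ x)) :=
    continuous_id.dotProduct (continuous_const.matrix_mulVec continuous_id)
  have hsphere : ∃ c, 0 < c ∧ ∀ x ∈ Metric.sphere (0 : m → ℝ) 1, c ≤ x ⬝ᵥ (P *ᵥ x) := by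
    rcases (Metric.sphere (0 : m → ℝ) 1).eq_empty_or_nonempty with h | h
    -- the unit sphere is empty when the index type is
    · exact ⟨1, one_pos, fun x hx => by simp [h] at hx⟩
    · obtain ⟨x₀, hx₀, hmin⟩ := (isCompact_sphere 0 1).exists_isMinOn h hcont.continuousOn
      refine ⟨_, hP.dotProduct_mulVec_pos (x := x₀) ?_, fun x hx => hmin hx⟩
      rintro rfl
      simp at hx₀
  obtain ⟨c, hc, h⟩ := hsphere
  refine ⟨c, hc, fun x => ?_⟩
  rcases eq_or_ne x 0 with rfl | hx
  · simp
  · have hn : ‖x‖ ≠ 0 := norm_ne_zero_iff.2 hx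
    have := h (‖x‖⁻¹ • x) (by simp [norm_smul, hn])
    rw [mulVec_smul, smul_dotProduct, dotProduct_smul, smul_eq_mul, smul_eq_mul, ← mul_assoc,
      ← mul_inv, inv_mul_eq_div, le_div_iff₀ (by positivity)] at this
    simpa [sq] using this

theorem _root_.HasDerivWithinAt.matrix_mulVec {n : Type*} [Fintype n] (P : Matrix n m ℝ)
    {v : ℝ → m → ℝ} {v' : m → ℝ} {s : Set ℝ} {t : ℝ} (h : HasDerivWithinAt v v' s t) :
    HasDerivWithinAt (fun t => P *ᵥ v t) (P *ᵥ v') s t :=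
  (LinearMap.toContinuousLinearMap P.mulVecLin).hasFDerivAt.comp_hasDerivWithinAt t h

theorem _root_.HasDerivWithinAt.dotProduct {v w : ℝ → m → ℝ} {v' w' : m → ℝ} {s : Set ℝ} {t : ℝ}
    (hv : HasDerivWithinAt v v' s t) (hw : HasDerivWithinAt w w' s t) :
    HasDerivWithinAt (fun t => v t ⬝ᵥ w t) (v' ⬝ᵥ w t + v t ⬝ᵥ w') s t := by
  simp only [_root_.dotProduct, ← Finset.sum_add_distrib]
  exact HasDerivWithinAt.fun_sum fun i _ =>
    (hasDerivWithinAt_pi.1 hv i).mul (hasDerivWithinAt_pi.1 hw i)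

theorem ExpDecay.mulVec {n : Type*} [Fintype n] (P : Matrix n m ℝ) {f : ℝ → m → ℝ}
    (hf : ExpDecay f) : ExpDecay (fun t => P *ᵥ f t) :=
  hf.clm (LinearMap.toContinuousLinearMap P.mulVecLin)

theorem SolvesODE.norm_sub_le {v f : ℝ → m → ℝ} (hv : SolvesODE v f) {L : ℝ}
    (hf : ∀ t, 0 ≤ t → ‖f t‖ ≤ L) {t : ℝ} (ht : 0 ≤ t) {r : ℝ} (hr : t ≤ r) :
    ‖v r - v t‖ ≤ L * (r - t) := by
  have := Convex.norm_image_sub_le_of_norm_hasDerivWithin_le (s := Set.Ici (0 : ℝ)) hv hf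
    (convex_Ici 0) (x := t) (y := r) ht (ht.trans hr)
  rwa [Real.norm_of_nonneg (by linarith)] at this

theorem exists_norm_mulVec_le {n : Type*} [Fintype n] (P : Matrix n m ℝ) :
    ∃ K, 0 ≤ K ∧ ∀ v, ‖P *ᵥ v‖ ≤ K * ‖v‖ :=
  ⟨_, norm_nonneg _, (LinearMap.toContinuousLinearMap P.mulVecLin).le_opNorm⟩

/-- The Lyapunov function `∑ k, Φ (z k) + (v ⬝ P v) / 2`, with `Φ` the primitive of the saturation,
decreases along `v' = σ(z)`, `z' = -P v - Q σ(z) + g` up to the perturbation by `g`, which is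
compensated by a multiple of an exponential. Hence `v` is bounded and `z` tends to zero. -/
theorem exists_bound_and_tendsto_zero {P Q : Matrix m m ℝ} (hP : P.PosDef) (hQ : Q.PosDef)
    {v z g : ℝ → m → ℝ} (hv : SolvesODE v (fun t => satVec (z t)))
    (hz : SolvesODE z (fun t => -(P *ᵥ v t) - Q *ᵥ satVec (z t) + g t)) (hg : ExpDecay g) :
    (∃ L, 0 < L ∧ ∀ t, 0 ≤ t → ‖-(P *ᵥ v t) - Q *ᵥ satVec (z t) + g t‖ ≤ L) ∧
      Tendsto z atTop (𝓝 0) := by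
  obtain ⟨c, hc, hcP⟩ := hP.exists_coercive
  obtain ⟨d, hd, hdQ⟩ := hQ.exists_coercive
  obtain ⟨K, a, hK, ha, -, hgK⟩ := hg.exists_bound one_pos
  set D : ℝ := Fintype.card m * K with hD
  have hD0 : 0 ≤ D := by positivity
  set U : ℝ → ℝ := fun t =>
    ∑ k, satPrimitive (z t k) + (v t ⬝ᵥ (P *ᵥ v t)) / 2 + D / a * Real.exp (-a * t) with hU
  set U' : ℝ → ℝ := fun t => -(satVec (z t) ⬝ᵥ (Q *ᵥ satVec (z t))) + satVec (z t) ⬝ᵥ g t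
    - D * Real.exp (-a * t) with hUd
  have hderiv : ∀ t, 0 ≤ t → HasDerivWithinAt U (U' t) (Set.Ici 0) t := by
    intro t ht
    have h1 : HasDerivWithinAt (fun t => ∑ k, satPrimitive (z t k))
        (satVec (z t) ⬝ᵥ (-(P *ᵥ v t) - Q *ᵥ satVec (z t) + g t)) (Set.Ici 0) t := by
      unfold dotProduct
      exact HasDerivWithinAt.fun_sum fun k _ =>
        HasDerivAt.comp_hasDerivWithinAt (h₂ := satPrimitive) (h₂' := satVec (z t) k) t
          (hasDerivAt_satPrimitive (z t k)) (hasDerivWithinAt_pi.1 (hz t ht) k)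
    have h2 := ((hv t ht).dotProduct ((hv t ht).matrix_mulVec P)).div_const 2
    have h3 : HasDerivAt (fun t => D / a * Real.exp (-a * t)) (-(D * Real.exp (-a * t))) t := by
      have h4 : HasDerivAt (fun t => -a * t) (-a) t := by
        simpa using (hasDerivAt_id t).const_mul (-a)
      refine (h4.exp.const_mul (D / a)).congr_deriv ?_
      field_simp
    refine ((h1.add h2).add h3.hasDerivWithinAt).congr_deriv ?_
    have hsymm : v t ⬝ᵥ (P *ᵥ satVec (z t)) = satVec (z t) ⬝ᵥ (P *ᵥ v t) := by
      have : Pᵀ = P := by simpa using hP.isHermitian.eq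
      rw [dotProduct_mulVec, dotProduct_comm, ← mulVec_transpose, this]
    rw [hsymm, hUd]
    simp only [dotProduct_add, dotProduct_sub, dotProduct_neg]
    ring
  have hdecay : ∀ t, 0 ≤ t → U' t ≤ -d * ‖satVec (z t)‖ ^ 2 := by
    intro t ht
    have h1 : satVec (z t) ⬝ᵥ g t ≤ D * Real.exp (-a * t) := by
      calc satVec (z t) ⬝ᵥ g t ≤ ∑ _k : m, K * Real.exp (-a * t) := by
            refine Finset.sum_le_sum fun k _ => (le_abs_self _).trans ?_
            rw [abs_mul]
            calc |satVec (z t) k| * |g t k| ≤ 1 * |g t k| :=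
                  mul_le_mul_of_nonneg_right (abs_sat_le_one _) (abs_nonneg _)
              _ ≤ K * Real.exp (-a * t) := by
                  rw [one_mul]; exact (norm_le_pi_norm (g t) k).trans (hgK t ht)
        _ = D * Real.exp (-a * t) := by
            rw [Finset.sum_const, nsmul_eq_mul, Finset.card_univ, hD, mul_assoc]
    have h2 := hdQ (satVec (z t))
    simp only [hUd]
    linarith
  have hvU : ∀ t, 0 ≤ t → c * ‖v t‖ ^ 2 / 2 ≤ U t := by
    intro t ht
    have h1 : 0 ≤ ∑ k, satPrimitive (z t k) := Finset.sum_nonneg fun k _ => satPrimitive_nonneg _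
    have h2 : 0 ≤ D / a * Real.exp (-a * t) := by positivity
    have h3 := hcP (v t)
    simp only [hU]
    linarith
  have hU0 : ∀ t, 0 ≤ t → 0 ≤ U t := fun t ht => le_trans (by positivity) (hvU t ht)
  have hanti : AntitoneOn U (Set.Ici 0) := by
    refine antitoneOn_of_hasDerivWithinAt_nonpos (convex_Ici 0)
      (fun t ht => (hderiv t ht).continuousWithinAt) (f' := U') (fun t ht => ?_) (fun t ht => ?_)
    · exact (hderiv t (interior_subset ht)).mono interior_subset
    · exact (hdecay t (interior_subset ht)).trans (by nlinarith [sq_nonneg ‖satVec (z t)‖])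
  obtain ⟨V, hV0, hV⟩ : ∃ V, 0 ≤ V ∧ ∀ t, 0 ≤ t → ‖v t‖ ≤ V := by
    refine ⟨√(2 * U 0 / c), Real.sqrt_nonneg _, fun t ht => Real.le_sqrt_of_sq_le ?_⟩
    rw [le_div_iff₀ hc]
    have h1 := hanti (Set.mem_Ici.2 le_rfl) (Set.mem_Ici.2 ht) ht
    linarith [hvU t ht]
  obtain ⟨KP, hKP0, hKP⟩ := exists_norm_mulVec_le P
  obtain ⟨KQ, hKQ0, hKQ⟩ := exists_norm_mulVec_le Q
  have hbound : ∀ t, 0 ≤ t →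
      ‖-(P *ᵥ v t) - Q *ᵥ satVec (z t) + g t‖ ≤ KP * V + KQ + K + 1 := by
    intro t ht
    have h1 : ‖P *ᵥ v t‖ ≤ KP * V := (hKP _).trans (mul_le_mul_of_nonneg_left (hV t ht) hKP0)
    have h2 : ‖Q *ᵥ satVec (z t)‖ ≤ KQ := by
      simpa using (hKQ _).trans (mul_le_mul_of_nonneg_left (norm_satVec_le_one (z t)) hKQ0)
    have h3 : ‖g t‖ ≤ K := by
      refine (hgK t ht).trans ?_
      have : Real.exp (-a * t) ≤ 1 := Real.exp_le_one_iff.2 (by nlinarith)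
      nlinarith
    have h4 := norm_add_le (-(P *ᵥ v t) - Q *ᵥ satVec (z t)) (g t)
    have h5 := norm_sub_le (-(P *ᵥ v t)) (Q *ᵥ satVec (z t))
    rw [norm_neg] at h5
    linarith
  have hL0 : 0 < KP * V + KQ + K + 1 := by positivity
  refine ⟨⟨_, hL0, hbound⟩, tendsto_pi_nhds.2 fun k => tendsto_zero_of_sat ?_⟩
  refine tendsto_zero_of_deriv_le_neg_sq hd hL0 hderiv hU0 (fun t ht => (hdecay t ht).trans ?_)
    fun t ht r hr => ?_
  · have h1 : |sat (z t k)| ≤ ‖satVec (z t)‖ := norm_le_pi_norm (satVec (z t)) k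
    have h2 : sat (z t k) ^ 2 ≤ ‖satVec (z t)‖ ^ 2 := by
      rw [← sq_abs]
      exact pow_le_pow_left₀ (abs_nonneg _) h1 2
    nlinarith
  · exact (abs_sat_sub_sat_le _ _).trans
      ((norm_le_pi_norm (z r - z t) k).trans (hz.norm_sub_le hbound ht hr))

/-- A double integrator `p' = v`, `v' = σ(z)` tends to zero if the signal `z` before saturation
approaches the feedback `-P p - Q v`, with `P` and `Q` positive definite, and satisfies the
differentiated feedback law up to an exponentially decaying error. Since `z` tends to zero, so does
`P p + Q v`, then its derivative `P v + Q σ(z)`, then `v`, and finally `p`. -/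
theorem doubleIntegrator_tendsto_zero [DecidableEq m] {P Q : Matrix m m ℝ} (hP : P.PosDef)
    (hQ : Q.PosDef) {p v z g : ℝ → m → ℝ} (hp : SolvesODE p v)
    (hv : SolvesODE v (fun t => satVec (z t)))
    (hz : SolvesODE z (fun t => -(P *ᵥ v t) - Q *ᵥ satVec (z t) + g t)) (hg : ExpDecay g)
    (hzpv : Tendsto (fun t => z t + (P *ᵥ p t + Q *ᵥ v t)) atTop (𝓝 0)) :
    Tendsto p atTop (𝓝 0) ∧ Tendsto v atTop (𝓝 0) := by
  obtain ⟨⟨L, hL, hbound⟩, hz0⟩ := exists_bound_and_tendsto_zero hP hQ hv hz hg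
  obtain ⟨KP, hKP0, hKP⟩ := exists_norm_mulVec_le P
  obtain ⟨KQ, hKQ0, hKQ⟩ := exists_norm_mulVec_le Q
  have hmul : ∀ (M : Matrix m m ℝ) {f : ℝ → m → ℝ}, Tendsto f atTop (𝓝 0) →
      Tendsto (fun t => M *ᵥ f t) atTop (𝓝 0) := fun M f hf => by
    have hcont : Continuous fun x : m → ℝ => M *ᵥ x := continuous_const.matrix_mulVec continuous_id
    exact (hcont.tendsto' 0 0 (mulVec_zero M)).comp hf
  have hinv : ∀ {f : ℝ → m → ℝ}, Tendsto (fun t => P *ᵥ f t) atTop (𝓝 0) → Tendsto f atTop (𝓝 0) :=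
    fun {f} hf => by
      have hdet : IsUnit P.det := (isUnit_iff_isUnit_det P).1 hP.isUnit
      simpa [mulVec_mulVec, nonsing_inv_mul P hdet] using hmul P⁻¹ hf
  have hsat : Tendsto (fun t => satVec (z t)) atTop (𝓝 0) := by
    refine squeeze_zero_norm (fun t => ?_) (tendsto_zero_iff_norm_tendsto_zero.1 hz0)
    have h0 : satVec (0 : m → ℝ) = 0 := by ext k; simp [satVec, sat]
    simpa [h0] using norm_satVec_sub_satVec_le (z t) 0
  have hy : Tendsto (fun t => P *ᵥ p t + Q *ᵥ v t) atTop (𝓝 0) := by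
    simpa using hzpv.sub hz0
  have hy' : Tendsto (fun t => P *ᵥ v t + Q *ᵥ satVec (z t)) atTop (𝓝 0) := by
    refine tendsto_deriv_zero_of_lipschitz (L := KP + KQ * L + 1) (by positivity)
      (fun t ht => ((hp t ht).matrix_mulVec P).add ((hv t ht).matrix_mulVec Q))
      (fun t ht r hr => ?_) hy
    have hrt : 0 ≤ r - t := sub_nonneg.2 hr
    have h1 : ‖P *ᵥ (v r - v t)‖ ≤ KP * (1 * (r - t)) := (hKP _).trans
      (mul_le_mul_of_nonneg_left (hv.norm_sub_le (fun t _ => norm_satVec_le_one _) ht hr) hKP0)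
    have h2 : ‖Q *ᵥ (satVec (z r) - satVec (z t))‖ ≤ KQ * (L * (r - t)) := (hKQ _).trans
      (mul_le_mul_of_nonneg_left
        ((norm_satVec_sub_satVec_le _ _).trans (hz.norm_sub_le hbound ht hr)) hKQ0)
    have h3 : P *ᵥ v r + Q *ᵥ satVec (z r) - (P *ᵥ v t + Q *ᵥ satVec (z t))
        = P *ᵥ (v r - v t) + Q *ᵥ (satVec (z r) - satVec (z t)) := by
      rw [mulVec_sub, mulVec_sub]; abel
    rw [h3]
    have h4 := norm_add_le (P *ᵥ (v r - v t)) (Q *ᵥ (satVec (z r) - satVec (z t)))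
    linarith
  have hv0 : Tendsto v atTop (𝓝 0) := hinv (by simpa using hy'.sub (hmul Q hsat))
  exact ⟨hinv (by simpa using hy.sub (hmul Q hv0)), hv0⟩

end

/-! ### The observer-based protocol -/

section

variable {N : ℕ} (G : WeightedGraph N) (R : Finset (Fin N)) {k l : Type*}

theorem WeightedGraph.mulVec_diffusive [Fintype k] (M : Matrix l k ℝ) (v : Fin N → k → ℝ) (i : Fin N) :
    M *ᵥ G.diffusive v i = G.diffusive (fun j => M *ᵥ v j) i := by
  simp only [WeightedGraph.diffusive, mulVec_sum, mulVec_smul, mulVec_sub]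

theorem WeightedGraph.diffusive_add (v w : Fin N → k → ℝ) (i : Fin N) :
    G.diffusive (fun j => v j + w j) i = G.diffusive v i + G.diffusive w i := by
  simp only [WeightedGraph.diffusive, ← Finset.sum_add_distrib, ← smul_add]
  exact Finset.sum_congr rfl fun j _ => by module

theorem WeightedGraph.diffusive_sub (v w : Fin N → k → ℝ) (i : Fin N) :
    G.diffusive (fun j => v j - w j) i = G.diffusive v i - G.diffusive w i := by
  simp only [WeightedGraph.diffusive, ← Finset.sum_sub_distrib, ← smul_sub]
  exact Finset.sum_congr rfl fun j _ => by module

theorem WeightedGraph.diffusive_const (c : k → ℝ) (i : Fin N) :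
    G.diffusive (fun _ => c) i = 0 := by
  simp [WeightedGraph.diffusive]

theorem WeightedGraph.hasDerivWithinAt_diffusive [Fintype k] {v : Fin N → ℝ → k → ℝ} {v' : Fin N → k → ℝ}
    {s : Set ℝ} {t : ℝ} (h : ∀ j, HasDerivWithinAt (v j) (v' j) s t) (i : Fin N) :
    HasDerivWithinAt (fun t => G.diffusive (fun j => v j t) i) (G.diffusive v' i) s t :=
  HasDerivWithinAt.fun_sum fun j _ => ((h i).sub (h j)).const_smul (G.a i j)

theorem measurement_eq [Fintype k] (M : Matrix l k ℝ) (x : Fin N → k → ℝ) (xr : k → ℝ) (i : Fin N) :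
    measurement G R M x xr i = M *ᵥ (G.diffusive x i + iota R i • (x i - xr)) := by
  rw [measurement, mulVec_add, mulVec_smul, mulVec_sub, WeightedGraph.mulVec_diffusive]

end

section

variable {m : ℕ}

theorem doubleA_mulVec (w : Fin m ⊕ Fin m → ℝ) :
    doubleA m *ᵥ w = Sum.elim (w ∘ Sum.inr) (0 : Fin m → ℝ) := by
  simp [doubleA, fromBlocks_mulVec]

theorem doubleB_mulVec (s : Fin m → ℝ) : doubleB m *ᵥ s = Sum.elim (0 : Fin m → ℝ) s := by
  simp [doubleB, fromRows_mulVec]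

end

section

variable {n m q : Type*} [Fintype n] [Fintype m] [Fintype q] {A : Matrix n n ℝ}
  {B : Matrix n m ℝ} {C : Matrix q n ℝ} {Fo : Matrix n q ℝ} {K : Matrix m n ℝ} {ρ : ℝ} {N : ℕ}
  {G : WeightedGraph N} {R : Finset (Fin N)} {x : Fin N → ℝ → n → ℝ} {xr : ℝ → n → ℝ}
  {xhat χ : Fin N → ℝ → n → ℝ} {u : Fin N → ℝ → m → ℝ}

/-- The observer reconstructs the network combination of the tracking errors: its error satisfies
`e' = (A - Fo C) e`. -/
theorem IsObserverTrajectory.observerError [DecidableEq n] (hFo : IsHurwitz (A - Fo * C))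
    (h : IsObserverTrajectory A B C Fo K ρ G R x xr xhat χ u) (i : Fin N) :
    ExpDecay fun t => G.diffusive (fun j => x j t) i + iota R i • (x i t - xr t) - xhat i t := by
  refine hFo.expDecay (f := fun _ => 0) (fun t ht => ?_) ExpDecay.zero
  refine (((G.hasDerivWithinAt_diffusive (fun j => h.agent j t ht) i).add
    (((h.agent i t ht).sub (h.exosystem t ht)).const_smul (iota R i))).sub
      (h.observer i t ht)).congr_deriv ?_
  dsimp only
  rw [measurement_eq, G.diffusive_add, ← G.mulVec_diffusive, ← G.mulVec_diffusive]
  simp only [sub_mulVec, ← mulVec_mulVec, mulVec_add, mulVec_sub, mulVec_smul]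
  module

/-- The error between the tracking error of an agent and the controller state is driven by the
grounded Laplacian, by `A` and by the observer error. -/
theorem IsObserverTrajectory.solvesODE_controllerError
    (h : IsObserverTrajectory A B C Fo K ρ G R x xr xhat χ u) (i : Fin N) :
    SolvesODE (fun t => x i t - xr t - χ i t) fun t =>
      A *ᵥ (x i t - xr t - χ i t)
        - (G.diffusive (fun j => x j t - xr t - χ j t) i + iota R i • (x i t - xr t - χ i t))
        + (G.diffusive (fun j => x j t) i + iota R i • (x i t - xr t) - xhat i t) := by
  intro t ht
  refine (((h.agent i t ht).sub (h.exosystem t ht)).sub (h.controller i t ht)).congr_deriv ?_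
  dsimp only
  rw [G.diffusive_sub, G.diffusive_sub, G.diffusive_const]
  simp only [mulVec_sub]
  module

end

section

variable {m : ℕ} {q : Type*} [Fintype q] {B : Matrix (Fin m ⊕ Fin m) (Fin m) ℝ}
  {C : Matrix q (Fin m ⊕ Fin m) ℝ} {Fo : Matrix (Fin m ⊕ Fin m) q ℝ} {ρ : ℝ} {N : ℕ}
  {G : WeightedGraph N} {R : Finset (Fin N)} {x : Fin N → ℝ → (Fin m ⊕ Fin m) → ℝ}
  {xr : ℝ → (Fin m ⊕ Fin m) → ℝ} {xhat χ : Fin N → ℝ → (Fin m ⊕ Fin m) → ℝ}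
  {u : Fin N → ℝ → Fin m → ℝ}

/-- For double integrators, the controller error decays exponentially: in each coordinate its
velocity part is governed by the grounded Laplacian, and its position part by the grounded
Laplacian with the velocity part as an additional input. -/
theorem IsObserverTrajectory.controllerError {K : Matrix (Fin m) (Fin m ⊕ Fin m) ℝ}
    (hFo : IsHurwitz (doubleA m - Fo * C)) (hG : G ∈ graphsRootedIn R)
    (h : IsObserverTrajectory (doubleA m) B C Fo K ρ G R x xr xhat χ u) (i : Fin N) :
    ExpDecay fun t => x i t - xr t - χ i t := by
  have hL := WeightedGraph.isHurwitz_neg_groundedLaplacian hG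
  have hcoord : ∀ (s : Fin m ⊕ Fin m),
      ExpDecay (fun t (j : Fin N) => (doubleA m *ᵥ (x j t - xr t - χ j t)) s) →
      ExpDecay (fun t (j : Fin N) => (x j t - xr t - χ j t) s) := by
    intro s hs
    refine hL.expDecay (f := fun t j => (doubleA m *ᵥ (x j t - xr t - χ j t)) s
      + (G.diffusive (fun j => x j t) j + iota R j • (x j t - xr t) - xhat j t) s)
      (fun t ht => hasDerivWithinAt_pi.2 fun j => ?_)
      (hs.add (ExpDecay.pi fun j => (h.observerError hFo j).apply s))
    refine (hasDerivWithinAt_pi.1 (h.solvesODE_controllerError j t ht) s).congr_deriv ?_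
    have := G.diffusive_add_iota R (fun j => x j t - xr t - χ j t) j s
    simp only [Pi.add_apply, neg_mulVec, Pi.neg_apply, ← this]
    simp only [Pi.add_apply, Pi.sub_apply, Pi.smul_apply, smul_eq_mul]
    ring
  have hvel : ∀ c, ExpDecay (fun t (j : Fin N) => (x j t - xr t - χ j t) (Sum.inr c)) := fun c =>
    hcoord _ (by simpa [doubleA_mulVec] using ExpDecay.pi fun _ => ExpDecay.zero (E := ℝ))
  have hpos : ∀ c, ExpDecay (fun t (j : Fin N) => (x j t - xr t - χ j t) (Sum.inl c)) := fun c =>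
    hcoord _ (by simpa [doubleA_mulVec] using hvel c)
  refine ExpDecay.pi fun s => ?_
  rcases s with c | c
  · exact (hpos c).apply i
  · exact (hvel c).apply i

/-- The controller state differs from the tracking error of its agent by an exponentially decaying
signal, and the same holds for their derivatives, so that each agent is a perturbed double integrator
under the saturated feedback. -/
theorem IsObserverTrajectory.regulatedSync {K₁ K₂ : Matrix (Fin m) (Fin m) ℝ}
    (hFo : IsHurwitz (doubleA m - Fo * C)) (hK₁ : IsNegDef K₁) (hK₂ : IsNegDef K₂) (hρ : 0 < ρ)
    (hG : G ∈ graphsRootedIn R)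
    (h : IsObserverTrajectory (doubleA m) (doubleB m) C Fo (fromCols K₁ K₂) ρ G R x xr xhat χ u) :
    RegulatedSync x xr := by
  have hmain : ∀ i, Tendsto (fun t => x i t - xr t) atTop (𝓝 0) := by
    intro i
    have he := h.controllerError hFo hG
    -- the deviation of the controller dynamics from those of the agent
    have hε : ExpDecay fun t => xhat i t - G.diffusive (fun j => χ j t) i - iota R i • χ i t := by
      have hd : ExpDecay fun t => G.diffusive (fun j => x j t - xr t - χ j t) i
          + iota R i • (x i t - xr t - χ i t) := by
        refine ExpDecay.pi fun s => ?_
        have h1 : ExpDecay fun t (j : Fin N) => (x j t - xr t - χ j t) s :=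
          ExpDecay.pi fun j => (he j).apply s
        refine ((h1.mulVec (G.groundedLaplacian R)).apply i).congr fun t _ => ?_
        rw [← G.diffusive_add_iota R (fun j => x j t - xr t - χ j t)]
        simp
      refine (hd.sub (h.observerError hFo i)).congr fun t _ => ?_
      rw [G.diffusive_sub, G.diffusive_sub, G.diffusive_const]
      module
    have hev : ExpDecay fun t c => (x i t - xr t - χ i t) (Sum.inr c) :=
      ExpDecay.pi fun c => (he i).apply _
    have hsatu : ∀ t, 0 ≤ t →
        satVec (u i t) = satVec (ρ • (fromCols K₁ K₂ *ᵥ χ i t)) := fun t ht => by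
      rw [h.input i t ht]
    have hx : SolvesODE (fun t => x i t - xr t) fun t => doubleA m *ᵥ (x i t - xr t)
        + doubleB m *ᵥ satVec (ρ • (fromCols K₁ K₂ *ᵥ χ i t)) := fun t ht => by
      refine ((h.agent i t ht).sub (h.exosystem t ht)).congr_deriv ?_
      dsimp only
      rw [hsatu t ht, mulVec_sub]
      abel
    have key := doubleIntegrator_tendsto_zero (P := ρ • -K₁) (Q := ρ • -K₂)
      (p := fun t c => (x i t - xr t) (Sum.inl c)) (v := fun t c => (x i t - xr t) (Sum.inr c))
      (z := fun t => ρ • (fromCols K₁ K₂ *ᵥ χ i t))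
      (g := fun t => ρ • (fromCols K₁ K₂ *ᵥ
          (xhat i t - G.diffusive (fun j => χ j t) i - iota R i • χ i t))
        - ρ • (K₁ *ᵥ fun c => (x i t - xr t - χ i t) (Sum.inr c)))
      (hK₁.smul hρ) (hK₂.smul hρ)
      (fun t ht => hasDerivWithinAt_pi.2 fun c =>
        (hasDerivWithinAt_pi.1 (hx t ht) (Sum.inl c)).congr_deriv ?_)
      (fun t ht => hasDerivWithinAt_pi.2 fun c =>
        (hasDerivWithinAt_pi.1 (hx t ht) (Sum.inr c)).congr_deriv ?_)
      (fun t ht => (((h.controller i t ht).matrix_mulVec (fromCols K₁ K₂)).const_smul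
        ρ).congr_deriv ?_)
      (by
        simp only [← smul_mulVec]
        exact (hε.mulVec (ρ • fromCols K₁ K₂)).sub (hev.mulVec (ρ • K₁)))
      ?_
    · rw [tendsto_pi_nhds] at key ⊢
      intro s
      rcases s with c | c
      · exact key.1 c
      · exact (tendsto_pi_nhds.1 key.2) c
    · simp [doubleA_mulVec, doubleB_mulVec]
    · simp [doubleA_mulVec, doubleB_mulVec]
    · dsimp only
      rw [hsatu t ht]
      set σ := satVec (ρ • (fromCols K₁ K₂ *ᵥ χ i t))
      have h1 : fromCols K₁ K₂ *ᵥ (doubleA m *ᵥ χ i t) = K₁ *ᵥ fun c => χ i t (Sum.inr c) := by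
        rw [doubleA_mulVec, fromCols_mulVec]
        simp only [Function.comp_def, Sum.elim_inl, Sum.elim_inr, Pi.zero_apply]
        exact (congrArg _ (mulVec_zero K₂)).trans (add_zero _)
      have h2 : fromCols K₁ K₂ *ᵥ (doubleB m *ᵥ σ) = K₂ *ᵥ σ := by
        rw [doubleB_mulVec, fromCols_mulVec]
        simp
      have h3 : (fun c => (x i t - xr t - χ i t) (Sum.inr c))
          = (fun c => (x i t - xr t) (Sum.inr c)) - fun c => χ i t (Sum.inr c) := rfl
      rw [h3]
      simp only [mulVec_add, mulVec_sub, h1, h2, smul_mulVec, neg_mulVec]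
      module
    · refine ((he i).mulVec (ρ • fromCols K₁ K₂)).neg.tendsto_zero.congr fun t => ?_
      have h1 : fromCols K₁ K₂ *ᵥ (x i t - xr t) = (K₁ *ᵥ fun c => (x i t - xr t) (Sum.inl c))
          + K₂ *ᵥ fun c => (x i t - xr t) (Sum.inr c) := by
        rw [fromCols_mulVec]; rfl
      simp only [smul_mulVec, neg_mulVec]
      rw [mulVec_sub _ (x i t - xr t), h1]
      module
  refine ⟨hmain, fun i j => ?_⟩
  simpa using (hmain i).sub (hmain j)

end

/-! ### Observer gains and the linear form of the protocol -/

/-- If the double integrator is observable from `C = (C₁ C₂)`, then `C₁` has trivial kernel: a state at rest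
at a position `w` with `C₁ w = 0` is an equilibrium with zero output. -/
theorem toCols₁_mulVec_eq_zero {m : ℕ} {q : Type*} [Fintype q] {C : Matrix q (Fin m ⊕ Fin m) ℝ}
    (hobs : IsObservable (doubleA m) C) {w : Fin m → ℝ} (hw : C.toCols₁ *ᵥ w = 0) : w = 0 := by
  have hinj : Function.Injective (observabilityMatrix (doubleA m) C).mulVec := by
    rw [mulVec_injective_iff, linearIndependent_iff_card_eq_finrank_span, Set.finrank,
      ← rank_eq_finrank_span_cols]
    exact hobs.symm
  have hC : C *ᵥ Sum.elim w 0 = 0 := by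
    rw [← fromCols_toCols C, fromCols_mulVec]
    simpa using hw
  have h0 : Sum.elim w 0 = (0 : Fin m ⊕ Fin m → ℝ) := by
    refine hinj ?_
    rw [mulVec_zero]
    ext ⟨k, r⟩
    have h1 : (observabilityMatrix (doubleA m) C *ᵥ Sum.elim w 0) (k, r)
        = ((C * doubleA m ^ (k : ℕ)) *ᵥ Sum.elim w 0) r := rfl
    rw [h1, ← mulVec_mulVec]
    rcases hk : (k : ℕ) with _ | k
    · simp [hC]
    · have h2 : doubleA m *ᵥ Sum.elim w 0 = 0 := by
        rw [doubleA_mulVec]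
        ext s
        rcases s with s | s <;> simp
      simp [pow_succ, ← mulVec_mulVec, h2]
  ext c
  simpa using congrFun h0 (Sum.inl c)

/-- An explicit stabilizing observer gain. With `Γ C₁ = 1` and `D = Γ C₂`, the signal `Γ C x` is
`s = p + D v`; the gain is chosen such that the error satisfies `s' = v - 2 s` and `v' = -s`, whose
only eigenvalue is `-1`. -/
theorem exists_isHurwitz_doubleA_sub {m q : ℕ} {C : Matrix (Fin q) (Fin m ⊕ Fin m) ℝ}
    (hobs : IsObservable (doubleA m) C) :
    ∃ Fo : Matrix (Fin m ⊕ Fin m) (Fin q) ℝ, IsHurwitz (doubleA m - Fo * C) := by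
  obtain ⟨Γ, hΓ⟩ : ∃ Γ : Matrix (Fin m) (Fin q) ℝ, Γ * C.toCols₁ = 1 := by
    have hker : LinearMap.ker (toLin' C.toCols₁) = ⊥ :=
      LinearMap.ker_eq_bot'.2 fun w hw => toCols₁_mulVec_eq_zero hobs (by simpa using hw)
    obtain ⟨g, hg⟩ := (toLin' C.toCols₁).exists_leftInverse_of_injective hker
    refine ⟨LinearMap.toMatrix' g, toLin'.injective ?_⟩
    rw [toLin'_mul, toLin'_toMatrix', hg, toLin'_one]
  set D : Matrix (Fin m) (Fin m) ℝ := Γ * C.toCols₂ with hD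
  refine ⟨fromRows ((2 - D) * Γ) Γ, ?_⟩
  have hM : doubleA m - fromRows ((2 - D) * Γ) Γ * C
      = fromBlocks (-(2 - D)) (1 - (2 - D) * D) (-1) (-D) := by
    conv_lhs => rw [← fromCols_toCols C, fromRows_mul_fromCols, doubleA]
    rw [sub_eq_add_neg, fromBlocks_neg, fromBlocks_add, Matrix.mul_assoc, Matrix.mul_assoc, hΓ, ← hD]
    simp [sub_eq_add_neg]
  rw [hM]
  intro l hl
  obtain ⟨z, hz⟩ := hl.exists_hasEigenvector
  have heq := hz.apply_eq_smul
  have hz0 := hz.2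
  set Dc : Matrix (Fin m) (Fin m) ℂ := D.map Complex.ofReal with hDc
  have hMc : (fromBlocks (-(2 - D)) (1 - (2 - D) * D) (-1) (-D)).map Complex.ofReal
      = fromBlocks (-(2 - Dc)) (1 - (2 - Dc) * Dc) (-1) (-Dc) := by
    have hmap : ∀ X : Matrix (Fin m) (Fin m) ℝ,
        X.map Complex.ofReal = Complex.ofRealHom.mapMatrix X := fun X => rfl
    rw [fromBlocks_map, hDc]
    simp only [hmap, map_neg, map_sub, map_mul, map_one, map_ofNat]
  set p : Fin m → ℂ := z ∘ Sum.inl with hp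
  set v : Fin m → ℂ := z ∘ Sum.inr with hv
  rw [toLin'_apply, hMc, fromBlocks_mulVec, ← hp, ← hv] at heq
  have h1 : -(2 - Dc) *ᵥ p + (1 - (2 - Dc) * Dc) *ᵥ v = l • p := by
    ext c; simpa [hp] using congrFun heq (Sum.inl c)
  have h2 : -p - Dc *ᵥ v = l • v := by
    ext c; simpa [hv, sub_eq_add_neg, neg_mulVec] using congrFun heq (Sum.inr c)
  have h3 : p = -(l • v) - Dc *ᵥ v := by rw [← h2]; abel
  have h4 : (l + 1) ^ 2 • v = 0 := by
    have two : ∀ w : Fin m → ℂ, (2 : Matrix (Fin m) (Fin m) ℂ) *ᵥ w = (2 : ℂ) • w := fun w => by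
      rw [← one_add_one_eq_two, add_mulVec, one_mulVec, ← one_add_one_eq_two, add_smul, one_smul]
    rw [h3] at h1
    simp only [sub_mulVec, neg_mulVec, ← mulVec_mulVec, mulVec_sub, mulVec_neg, mulVec_smul,
      one_mulVec, two] at h1
    have h5 : (l + 1) ^ 2 • v = (-((2 : ℂ) • (-(l • v) - Dc *ᵥ v)
      - (-(l • Dc *ᵥ v) - Dc *ᵥ (Dc *ᵥ v))) + (v - ((2 : ℂ) • (Dc *ᵥ v) - Dc *ᵥ (Dc *ᵥ v))))
      - l • (-(l • v) - Dc *ᵥ v) := by module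
    rw [h5, sub_eq_zero]
    convert h1 using 1
    module
  have hv0 : v ≠ 0 := by
    intro h0
    have hp0 : p = 0 := by rw [h3, h0]; simp
    refine hz0 (funext fun s => ?_)
    rcases s with c | c
    · exact congrFun hp0 c
    · exact congrFun h0 c
  have h6 : l + 1 = 0 := by
    simpa using (smul_eq_zero.1 h4).resolve_right hv0
  rw [eq_neg_of_add_eq_zero_left h6]
  simp

section

variable {n m q : Type*} [Fintype n] [DecidableEq n] [DecidableEq m] [Fintype q]

/-- The observer-based protocol with `ρ = 1` as a linear protocol: the protocol state is the pair of
the observer state and the controller state `χ`, and the pair `(χ, σ(u))` is communicated. -/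
def observerProtocol (A : Matrix n n ℝ) (B : Matrix n m ℝ) (C : Matrix q n ℝ) (Fo : Matrix n q ℝ)
    (K : Matrix m n ℝ) : LinearProtocol (n ⊕ n) (n ⊕ m) m q where
  Ac := fromBlocks (A - Fo * C) 0 1 A
  Bc := fromRows 0 B
  Cc := fromRows Fo 0
  Dc := fromBlocks 0 B (-1) 0
  Ec := fromBlocks 0 B (-1) 0
  Fc := fromCols 0 K
  Hc := fromBlocks 0 1 0 0
  Jc := fromRows 0 1

variable {A : Matrix n n ℝ} {B : Matrix n m ℝ} {C : Matrix q n ℝ} {Fo : Matrix n q ℝ}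
  {K : Matrix m n ℝ}

theorem observerProtocol_input (xc : n ⊕ n → ℝ) :
    (observerProtocol A B C Fo K).input xc = K *ᵥ (xc ∘ Sum.inr) := by
  simp [LinearProtocol.input, observerProtocol, fromCols_mulVec]

theorem observerProtocol_exchanged [Fintype m] (xc : n ⊕ n → ℝ) :
    (observerProtocol A B C Fo K).exchanged xc
      = Sum.elim (xc ∘ Sum.inr) (satVec (K *ᵥ (xc ∘ Sum.inr))) := by
  rw [LinearProtocol.exchanged, observerProtocol_input]
  ext s
  rcases s with s | s <;> simp [observerProtocol, fromBlocks_mulVec, fromRows_mulVec]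

theorem isObserverTrajectory_of_isTrajectory [Fintype m] {N : ℕ} {G : WeightedGraph N} {R : Finset (Fin N)}
    {x : Fin N → ℝ → n → ℝ} {xr : ℝ → n → ℝ} {xc : Fin N → ℝ → n ⊕ n → ℝ}
    (h : (observerProtocol A B C Fo K).IsTrajectory A B C G R x xr xc) :
    IsObserverTrajectory A B C Fo K 1 G R x xr (fun i t => xc i t ∘ Sum.inl)
      (fun i t => xc i t ∘ Sum.inr) (fun i t => K *ᵥ (xc i t ∘ Sum.inr)) where
  exosystem := h.exosystem
  agent i := by simpa only [observerProtocol_input] using h.agent i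
  observer i t ht := by
    refine hasDerivWithinAt_pi.2 fun s =>
      (hasDerivWithinAt_pi.1 (h.protocol i t ht) (Sum.inl s)).congr_deriv ?_
    simp only [observerProtocol_input, observerProtocol_exchanged]
    have hd : G.diffusive (fun j => Sum.elim (xc j t ∘ Sum.inr)
        (satVec (K *ᵥ (xc j t ∘ Sum.inr)))) i ∘ Sum.inr
        = G.diffusive (fun j => satVec (K *ᵥ (xc j t ∘ Sum.inr))) i := by
      ext r
      simp [G.diffusive_apply]
    simp [observerProtocol, fromBlocks_mulVec, fromRows_mulVec, sub_mulVec, mulVec_sub, hd,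
      ← mulVec_mulVec]
    ring
  controller i t ht := by
    refine hasDerivWithinAt_pi.2 fun s =>
      (hasDerivWithinAt_pi.1 (h.protocol i t ht) (Sum.inr s)).congr_deriv ?_
    simp only [observerProtocol_input, observerProtocol_exchanged]
    have hd : G.diffusive (fun j => Sum.elim (xc j t ∘ Sum.inr)
        (satVec (K *ᵥ (xc j t ∘ Sum.inr)))) i ∘ Sum.inl
        = G.diffusive (fun j => xc j t ∘ Sum.inr) i := by
      ext r
      simp [G.diffusive_apply]
    simp [observerProtocol, fromBlocks_mulVec, fromRows_mulVec, neg_mulVec, hd]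
    ring
  input i t _ := (one_smul ℝ _).symm

end

end MAS

theorem mainTheorem3 (m q : ℕ) (C : Matrix (Fin q) (Fin m ⊕ Fin m) ℝ)
    (hobs : MAS.IsObservable (MAS.doubleA m) C) :
    MAS.ScalableSyncSolvable (MAS.doubleA m) (MAS.doubleB m) C ∧
    ∀ (Fo : Matrix (Fin m ⊕ Fin m) (Fin q) ℝ), MAS.IsHurwitz (MAS.doubleA m - Fo * C) →
    ∀ (K₁ K₂ : Matrix (Fin m) (Fin m) ℝ), MAS.IsNegDef K₁ → MAS.IsNegDef K₂ →
    ∀ (ρ : ℝ), 0 < ρ →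
    ∀ (N : ℕ) (R : Finset (Fin N)), R.Nonempty → ∀ G ∈ MAS.graphsRootedIn R,
    ∀ (x : Fin N → ℝ → (Fin m ⊕ Fin m) → ℝ) (xr : ℝ → (Fin m ⊕ Fin m) → ℝ)
      (xhat χ : Fin N → ℝ → (Fin m ⊕ Fin m) → ℝ) (u : Fin N → ℝ → Fin m → ℝ),
      MAS.IsObserverTrajectory (MAS.doubleA m) (MAS.doubleB m) C Fo (Matrix.fromCols K₁ K₂) ρ
        G R x xr xhat χ u →
      MAS.RegulatedSync x xr := by
  refine ⟨?_, fun Fo hFo K₁ K₂ hK₁ hK₂ ρ hρ N R _ G hG x xr xhat χ u h =>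
    h.regulatedSync hFo hK₁ hK₂ hρ hG⟩
  obtain ⟨Fo, hFo⟩ := MAS.exists_isHurwitz_doubleA_sub hobs
  have hK : MAS.IsNegDef (-1 : Matrix (Fin m) (Fin m) ℝ) := by
    simpa [MAS.IsNegDef] using Matrix.PosDef.one
  exact ⟨_, _, inferInstance, inferInstance,
    MAS.observerProtocol (MAS.doubleA m) (MAS.doubleB m) C Fo (Matrix.fromCols (-1) (-1)),
    fun N R _ G hG x xr xc h =>
      (MAS.isObserverTrajectory_of_isTrajectory h).regulatedSync hFo hK hK one_pos hG⟩
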